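/- Let $q=p^f$ with $p$ prime and $f\ge 1$, and put $n=q+1$. Assume that $n>3$, that $n=2^sr^t$ for some odd prime $r$ and integers $s,t\ge 0$, and that $s\ge 2$ or $q$ is even. Let $X$ be a finite almost simple group with socle $T$ and $|X:T|\le 2$. Assume that $X$ has a subgroup $R\cong \mathrm{AGL}_1(q)$, and write $R=F{:}(\langle b\rangle\times\langle c\rangle)$, where $F\cong\mathbb Z_p^f$, $b$ has order $\frac{q-1}{(2,q-1)}$ and $c$ has order $(2,q-1)$. Let $\tau=(1,2,\ldots,n)\in S_n$ and let $W=X\wr\langle\tau\rangle=X^n{:}\langle\tau\rangle$, where $(x_1,x_2,\ldots,x_n)^\tau=(x_n,x_1,\ldots,x_{n-1})$. Let $\pi_i:X^n\to X$ be the $i$-th projection, for $1\le i\le n$. For $Y\le X$ regard $Y^n$ as a subgroup of $W$. Put $$\theta=(bc,b,bc,\ldots,bc)\,\tau\in W$$ (all entries of the tuple are $bc$ except the second, which is $b$). Let $E\le X^n$ be a minimal normal subgroup of $F^n{:}\langle\theta\rangle$ such that 1. $E\cong\mathbb Z_p^{2f}$; 2. $\langle\theta\rangle$ acts transitively on $E\setminus\{1\}$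 by conjugation; 3. $\pi_i(E)=F$ for all $i$, and $\ker(\pi_i)\cap E\ne\ker(\pi_j)\cap E$ for $i\neq j$. Let $G=T^n\langle\theta\rangle$ and $H=E{:}\langle\theta\rangle$; these are subgroups of $W$ with $H\le G$. For a group $G$, a subgroup $H\le G$ and a $2$-element $g\in G\setminus H$ with $g^2\in H$, the coset graph $\mathrm{Cos}(G,H,g)$ is the graph whose vertices are the right cosets $Hx$, $x\in G$, with $Hx$ and $Hy$ adjacent if and only if $yx^{-1}\in HgH$; the group $G$ acts on it by right multiplication. A graph is called $(G,2)$-arc-transitive if $G$ acts on it faithfully by automorphisms and transitively on its $2$-arcs, that is, on the triples $(\alpha,\beta,\gamma)$ of distinct vertices with $\alpha$ adjacent to $\beta$ and $\beta$ adjacent to $\gamma$. **Theorem.** Suppose that the normalizer $N_X(\langle b,c\rangle)$ contains an involution $o\in T$ with $X=\langle F,b,c,o\rangle$, and let $\mathbf o=(o,o,\ldots,o)\in X^n$. Then $\mathbf o$ is a $2$-element of $G\setminus H$ with $\mathbf o^2\in H$, and the coset graph $\mathrm{Cos}(G,H,\mathbf o)$ is connected, $(G,2)$-arc-transitive, and of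 valency $q^2$. -/

import Mathlib

namespace CosetGraphPA

/-! ### Groups -/

/-- `M` is a minimal normal subgroup of `A`. -/
def IsMinimalNormal {A : Type*} [Group A] (M : Subgroup A) : Prop :=
  M.Normal ∧ M ≠ ⊥ ∧ ∀ K : Subgroup A, K.Normal → K ≠ ⊥ → K ≤ M → K = M

/-- `M`, a subgroup of `A`, is a minimal normal subgroup of the subgroup `N` of `A`. -/
def IsMinimalNormalIn {A : Type*} [Group A] (M N : Subgroup A) : Prop :=
  M ≤ N ∧ IsMinimalNormal (M.subgroupOf N)

/-- The socle: the subgroup generated by all minimal normal subgroups. -/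
def socle (A : Type*) [Group A] : Subgroup A :=
  sSup {M : Subgroup A | IsMinimalNormal M}

/-- A (finite) group is almost simple if its socle is a nonabelian simple group. -/
def IsAlmostSimple (A : Type*) [Group A] : Prop :=
  IsSimpleGroup (socle A) ∧ ∃ x ∈ socle A, ∃ y ∈ socle A, ¬ Commute x y

/-- `R = F : K`, an internal semidirect product with normal factor `F`. -/
structure IsInternalSemidirect {A : Type*} [Group A] (R F K : Subgroup A) : Prop where
  sup_eq : F ⊔ K = R
  normal : (F.subgroupOf R).Normal
  disjoint : F ⊓ K = ⊥

/-- `K = B × C`, an internal direct product. -/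
structure IsInternalDirect {A : Type*} [Group A] (K B C : Subgroup A) : Prop where
  sup_eq : B ⊔ C = K
  commute : ∀ x ∈ B, ∀ y ∈ C, Commute x y
  disjoint : B ⊓ C = ⊥

/-- The one-dimensional affine group `AGL₁(p ^ f)`: all affine bijections of the affine line
over the field with `p ^ f` elements. -/
abbrev AGL1 (p f : ℕ) [Fact p.Prime] : Type :=
  GaloisField p f ≃ᵃ[GaloisField p f] GaloisField p f

/-- The elementary abelian group `ℤ_p ^ k`, written multiplicatively. -/
abbrev ElemAb (p k : ℕ) : Type := Multiplicative (Fin k → ZMod p)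

/-! ### The wreath product `X ≀ ⟨τ⟩` with `τ = (1, 2, …, n)` -/

/-- Coordinates are indexed by `Fin n`, so that `i : Fin n` stands for the coordinate `i + 1`;
`finRotate n` is the cycle `i ↦ i + 1`, that is, `(1, 2, …, n)`. -/
abbrev Rot (n : ℕ) : Subgroup (Equiv.Perm (Fin n)) := Subgroup.zpowers (finRotate n)

/-- The action of `⟨τ⟩` on `X ^ n`. -/
def rotAction (X : Type*) [Group X] (n : ℕ) : Rot n →* MulAut (Fin n → X) where
  toFun σ :=
    { toFun := fun x i => x (σ.1 i)
      invFun := fun x i => x (σ.1.symm i)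
      left_inv := fun x => by funext i; simp
      right_inv := fun x => by funext i; simp
      map_mul' := fun _ _ => rfl }
  map_one' := rfl
  map_mul' := fun σ ρ => by
    rw [mul_comm' σ ρ]
    rfl

/-- The wreath product `W = X ≀ ⟨τ⟩ = X ^ n : ⟨τ⟩`. -/
abbrev Wreath (X : Type*) [Group X] (n : ℕ) : Type _ :=
  (Fin n → X) ⋊[rotAction X n] (Rot n)

/-- The embedding of the base group `X ^ n` into `W`. -/
abbrev base (X : Type*) [Group X] (n : ℕ) : (Fin n → X) →* Wreath X n :=
  SemidirectProduct.inl

/-- The element `τ` of `W`. -/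
def tau (X : Type*) [Group X] (n : ℕ) : Wreath X n :=
  SemidirectProduct.inr ⟨finRotate n, Subgroup.mem_zpowers _⟩

/-- `(x₁, x₂, …, xₙ) ^ τ = (xₙ, x₁, …, xₙ₋₁)`, where `x ^ τ = τ⁻¹ x τ`. -/
theorem tau_conj (X : Type*) [Group X] (n : ℕ) (x : Fin n → X) :
    (tau X n)⁻¹ * base X n x * tau X n = base X n (fun i => x ((finRotate n).symm i)) := by
  have h := SemidirectProduct.inl_aut_inv (φ := rotAction X n)
    (⟨finRotate n, Subgroup.mem_zpowers _⟩ : Rot n) x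
  rw [tau, ← map_inv, ← h]
  rfl

/-- The direct power `Y ^ n`, as a subgroup of `W`. -/
def power {X : Type*} [Group X] (n : ℕ) (Y : Subgroup X) : Subgroup (Wreath X n) :=
  (Subgroup.pi Set.univ fun _ : Fin n => Y).map (base X n)

/-- The projection `π_i : X ^ n → X`. -/
abbrev proj (X : Type*) [Group X] (n : ℕ) (i : Fin n) : (Fin n → X) →* X :=
  Pi.evalMonoidHom (fun _ : Fin n => X) i

/-- `d₀ = (bc, b, bc, …, bc)`. -/
def dZero {X : Type*} [Group X] (n : ℕ) (b c : X) : Fin n → X :=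
  fun i => if i.val = 1 then b else b * c

/-- `θ = d₀ τ`. -/
def theta {X : Type*} [Group X] (n : ℕ) (b c : X) : Wreath X n :=
  base X n (dZero n b c) * tau X n

/-- `G = T ^ n ⟨θ⟩`, as a subgroup of `W`. -/
def groupG {X : Type*} [Group X] (n : ℕ) (T : Subgroup X) (b c : X) : Subgroup (Wreath X n) :=
  power n T ⊔ Subgroup.zpowers (theta n b c)

/-- `H = E ⟨θ⟩` for `E ≤ X ^ n`, as a subgroup of `W`. -/
def groupH {X : Type*} [Group X] (n : ℕ) (E : Subgroup (Fin n → X)) (b c : X) :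
    Subgroup (Wreath X n) :=
  E.map (base X n) ⊔ Subgroup.zpowers (theta n b c)

/-- The diagonal element `(o, o, …, o)` of `W`. -/
def diag {X : Type*} [Group X] (n : ℕ) (o : X) : Wreath X n :=
  base X n fun _ => o

/-- The properties required of `E ≤ X ^ n`: it is a minimal normal subgroup of `F ^ n : ⟨θ⟩`
such that (1) `E ≅ ℤ_p ^ (2 f)`, (2) `⟨θ⟩` acts transitively by conjugation on `E \ {1}`,
(3) all projections of `E` are equal to `F`, and the kernels of the projections restricted to `E`
are pairwise distinct. -/
structure IsAdmissible {X : Type*} [Group X] (p f n : ℕ) (F : Subgroup X) (b c : X)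
    (E : Subgroup (Fin n → X)) : Prop where
  minimal : IsMinimalNormalIn (E.map (base X n)) (power n F ⊔ Subgroup.zpowers (theta n b c))
  elemAb : Nonempty (E ≃* ElemAb p (2 * f))
  transitive : ∀ x ∈ E, ∀ y ∈ E, x ≠ 1 → y ≠ 1 →
    ∃ g ∈ Subgroup.zpowers (theta n b c), g⁻¹ * base X n x * g = base X n y
  proj_eq : ∀ i, E.map (proj X n i) = F
  ker_ne : ∀ i j, i ≠ j → (proj X n i).ker ⊓ E ≠ (proj X n j).ker ⊓ E

/-! ### Coset graphs -/

/-- The set `[G : H]` of right cosets `H x`. -/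
def RightCosets {G : Type*} [Group G] (H : Subgroup G) : Type _ :=
  Quotient (QuotientGroup.rightRel H)

/-- The right coset `H x`. -/
def RightCosets.mk {G : Type*} [Group G] (H : Subgroup G) (x : G) : RightCosets H :=
  Quotient.mk (QuotientGroup.rightRel H) x

theorem RightCosets.mk_eq_iff {G : Type*} [Group G] {H : Subgroup G} {x y : G} :
    RightCosets.mk H x = RightCosets.mk H y ↔ y * x⁻¹ ∈ H :=
  Quotient.eq.trans QuotientGroup.rightRel_apply

/-- `G` acts on `[G : H]` by right multiplication, `(H x) ^ g = H (x g)`. A right action of `G`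
is an action of the opposite group. -/
instance {G : Type*} [Group G] (H : Subgroup G) : MulAction Gᵐᵒᵖ (RightCosets H) where
  smul g := Quotient.map' (fun x => x * g.unop) fun x y h => by
    rw [QuotientGroup.rightRel_apply] at h ⊢
    simpa [mul_assoc] using h
  one_smul v := Quotient.inductionOn v fun x => congrArg (RightCosets.mk H) (mul_one x)
  mul_smul g k v := Quotient.inductionOn v fun x =>
    congrArg (RightCosets.mk H) (mul_assoc x k.unop g.unop).symm

theorem RightCosets.op_smul_mk {G : Type*} [Group G] (H : Subgroup G) (g x : G) :
    MulOpposite.op g • RightCosets.mk H x = RightCosets.mk H (x * g) := rfl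

/-- The requirement on `g` in the definition of the coset graph: `g` is a `2`-element of `G \ H`
with `g ^ 2 ∈ H`. -/
structure IsCosetGraphElement {G : Type*} [Group G] (H : Subgroup G) (g : G) : Prop where
  two_element : ∃ k : ℕ, orderOf g = 2 ^ k
  notMem : g ∉ H
  sq_mem : g ^ 2 ∈ H

/-- The coset graph `Cos(G, H, g)`: the vertices are the right cosets of `H` in `G`, and `H x` is
adjacent to `H y` if and only if `y x⁻¹ ∈ H g H`. -/
def cosetGraph {G : Type*} [Group G] (H : Subgroup G) (g : G) (hg : IsCosetGraphElement H g) :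
    SimpleGraph (RightCosets H) where
  Adj u v := ∃ x y, u = RightCosets.mk H x ∧ v = RightCosets.mk H y ∧
    y * x⁻¹ ∈ DoubleCoset.doubleCoset g (H : Set G) (H : Set G)
  symm := ⟨by
    rintro u v ⟨x, y, hu, hv, h⟩
    refine ⟨y, x, hv, hu, ?_⟩
    obtain ⟨a, ha, d, hd, e⟩ := DoubleCoset.mem_doubleCoset.1 h
    refine DoubleCoset.mem_doubleCoset.2
      ⟨d⁻¹, H.inv_mem hd, (g ^ 2)⁻¹ * a⁻¹, H.mul_mem (H.inv_mem hg.sq_mem) (H.inv_mem ha), ?_⟩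
    calc x * y⁻¹ = (y * x⁻¹)⁻¹ := by group
      _ = (a * g * d)⁻¹ := by rw [e]
      _ = d⁻¹ * g * ((g ^ 2)⁻¹ * a⁻¹) := by group⟩
  loopless := ⟨by
    rintro u ⟨x, y, hx, hy, h⟩
    have hxy : y * x⁻¹ ∈ H := RightCosets.mk_eq_iff.1 (hx.symm.trans hy)
    obtain ⟨a, ha, d, hd, e⟩ := DoubleCoset.mem_doubleCoset.1 h
    refine hg.notMem ?_
    have : g = a⁻¹ * (y * x⁻¹) * d⁻¹ := by rw [e]; group
    rw [this]
    exact H.mul_mem (H.mul_mem (H.inv_mem ha) hxy) (H.inv_mem hd)⟩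

/-- Adjacency does not depend on the choice of representatives. -/
theorem cosetGraph_adj {G : Type*} [Group G] (H : Subgroup G) (g : G)
    (hg : IsCosetGraphElement H g) (x y : G) :
    (cosetGraph H g hg).Adj (RightCosets.mk H x) (RightCosets.mk H y) ↔
      y * x⁻¹ ∈ DoubleCoset.doubleCoset g (H : Set G) (H : Set G) := by
  refine ⟨?_, fun h => ⟨x, y, rfl, rfl, h⟩⟩
  rintro ⟨x', y', hx, hy, h⟩
  rw [RightCosets.mk_eq_iff] at hx hy
  obtain ⟨a, ha, d, hd, e⟩ := DoubleCoset.mem_doubleCoset.1 h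
  refine DoubleCoset.mem_doubleCoset.2
    ⟨(y' * y⁻¹)⁻¹ * a, H.mul_mem (H.inv_mem hy) ha, d * (x' * x⁻¹), H.mul_mem hd hx, ?_⟩
  calc y * x⁻¹ = (y' * y⁻¹)⁻¹ * (y' * x'⁻¹) * (x' * x⁻¹) := by group
    _ = (y' * y⁻¹)⁻¹ * (a * g * d) * (x' * x⁻¹) := by rw [e]
    _ = (y' * y⁻¹)⁻¹ * a * g * (d * (x' * x⁻¹)) := by group

/-- A `2`-arc: three distinct vertices `u, v, w` with `u ~ v` and `v ~ w`. -/
def IsTwoArc {V : Type*} (Γ : SimpleGraph V) (u v w : V) : Prop :=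
  u ≠ v ∧ v ≠ w ∧ u ≠ w ∧ Γ.Adj u v ∧ Γ.Adj v w

/-- `Γ` is `(A, 2)`-arc-transitive: `A` acts faithfully by automorphisms of `Γ`, that is, as a
subgroup of `Aut Γ`, and it is transitive on the `2`-arcs of `Γ`. -/
structure IsTwoArcTransitive (A : Type*) {V : Type*} [Group A] [MulAction A V]
    (Γ : SimpleGraph V) : Prop where
  faithful : FaithfulSMul A V
  adj_iff : ∀ (a : A) (u v : V), Γ.Adj (a • u) (a • v) ↔ Γ.Adj u v
  transitive : ∀ u v w u' v' w' : V, IsTwoArc Γ u v w → IsTwoArc Γ u' v' w' →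
    ∃ a : A, a • u = u' ∧ a • v = v' ∧ a • w = w'

end CosetGraphPA

open CosetGraphPA

namespace CosetGraphPA

/-! ### Coset graphs with a sharply transitive normal factor in the vertex stabilizer -/

/-! Write `𝐨` for the diagonal element `(o, …, o)` and `a = b²c`. The theorem rests on two facts:
`𝐨` normalizes `⟨θ⟩`, but it does not normalize `H = E⟨θ⟩`. As `⟨θ⟩` is transitive on `E \ {1}`, no
nontrivial element of `E` is then conjugated into `H` by `𝐨` (`IsAffineAmalgam.eq_one_of_conj_mem`).
So the neighbours of the vertex `H` are the cosets `H𝐨e`, pairwise distinct for `e ∈ E`: the group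
`E` is regular on them, and `⟨θ⟩` fixes `H𝐨` and is transitive on the others. This gives valency
`|E| = q²` and 2-arc-transitivity.

For the first fact, `θⁿ` is the constant tuple `a` (`theta_pow_card`). The arithmetic hypotheses
make the order of `b` odd, so `⟨a⟩ = ⟨b, c⟩` and `o` centralizes `c`. Hence conjugation by `𝐨`
multiplies `θ` by a power of `θⁿ` (`diag_conj_mem_zpowers`).

For connectedness, `⟨H, 𝐨⟩` meets `Xⁿ` in a group that projects onto `X` in every coordinate (`E`
supplies `F`, and `θⁿ` supplies `b` and `c`) and whose elements from `E` separate the coordinates,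
so it contains `Tⁿ` (`IsAlmostSimple.pi_socle_le`).

If `N ≤ H` is normal in `G`, then commutators of `N ∩ Xⁿ` lie in `E ≤ Fⁿ`, because `H/E` is cyclic.
A nontrivial projection of `N ∩ Xⁿ` would contain `T`, forcing the perfect group `T` into the
abelian group `F`. Thus `H` is core-free, and `𝐨` cannot normalize `H`.

Finally `E ≤ Tⁿ`: otherwise `[E, θⁿ] ≤ E ∩ Tⁿ = 1`, and `⟨θ⟩` would have orbits of length at most `n
< q² - 1` on `E \ {1}`. -/

theorem RightCosets.ind {G : Type*} [Group G] {H : Subgroup G} {P : RightCosets H → Prop}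
    (h : ∀ x, P (RightCosets.mk H x)) (v : RightCosets H) : P v :=
  Quotient.inductionOn v h

theorem RightCosets.mk_mul_eq {G : Type*} [Group G] {H : Subgroup G} {h : G} (hh : h ∈ H) (x : G) :
    RightCosets.mk H (h * x) = RightCosets.mk H x := by
  rw [RightCosets.mk_eq_iff]
  simpa using H.inv_mem hh

theorem cosetGraph_adj_smul {G : Type*} [Group G] (H : Subgroup G) (g : G)
    (hg : IsCosetGraphElement H g) (a : Gᵐᵒᵖ) (u v : RightCosets H) :
    (cosetGraph H g hg).Adj (a • u) (a • v) ↔ (cosetGraph H g hg).Adj u v := by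
  induction u using RightCosets.ind with | h x => ?_
  induction v using RightCosets.ind with | h y => ?_
  obtain ⟨a, rfl⟩ := MulOpposite.op_surjective a
  rw [RightCosets.op_smul_mk, RightCosets.op_smul_mk, cosetGraph_adj, cosetGraph_adj]
  simp [mul_assoc]

/-- Right multiplication is an automorphism, so paths from `H` can be concatenated along a word in
the generators. -/
theorem cosetGraph_connected {G : Type*} [Group G] (H : Subgroup G) (g : G)
    (hg : IsCosetGraphElement H g) (hgen : Subgroup.closure ((H : Set G) ∪ {g}) = ⊤) :
    (cosetGraph H g hg).Connected := by
  have hsmul : ∀ (a : G) (x y : G),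
      (cosetGraph H g hg).Reachable (RightCosets.mk H x) (RightCosets.mk H y) →
      (cosetGraph H g hg).Reachable (RightCosets.mk H (x * a)) (RightCosets.mk H (y * a)) := by
    intro a x y hxy
    let φ : cosetGraph H g hg →g cosetGraph H g hg :=
      ⟨fun v => MulOpposite.op a • v, fun {u v} h => (cosetGraph_adj_smul H g hg _ u v).2 h⟩
    exact hxy.map φ
  have hone : ∀ x : G,
      (cosetGraph H g hg).Reachable (RightCosets.mk H 1) (RightCosets.mk H x) := by
    intro x
    have hx : x ∈ Subgroup.closure ((H : Set G) ∪ {g}) := hgen ▸ Subgroup.mem_top x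
    induction hx using Subgroup.closure_induction with
    | mem x hx =>
      rcases hx with hx | hx
      · rw [RightCosets.mk_eq_iff.2 (show x * 1⁻¹ ∈ H by simpa using hx)]
      · rw [Set.mem_singleton_iff.1 hx]
        refine SimpleGraph.Adj.reachable ((cosetGraph_adj _ _ _ _ _).2 ?_)
        exact DoubleCoset.mem_doubleCoset.2 ⟨1, H.one_mem, 1, H.one_mem, by simp⟩
    | one => exact SimpleGraph.Reachable.refl _
    | mul x y _ _ hx hy =>
      have := hsmul y _ _ hx
      rw [one_mul] at this
      exact hy.trans this
    | inv x _ hx =>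
      have := hsmul x⁻¹ _ _ hx
      rw [one_mul, mul_inv_cancel] at this
      exact this.symm
  have : Nonempty (RightCosets H) := ⟨RightCosets.mk H 1⟩
  refine SimpleGraph.Connected.mk fun u v => ?_
  induction u using RightCosets.ind with | h x => ?_
  induction v using RightCosets.ind with | h y => ?_
  exact (hone x).symm.trans (hone y)

theorem RightCosets.faithfulSMul {G : Type*} [Group G] (H : Subgroup G)
    (hcore : H.normalCore = ⊥) : FaithfulSMul Gᵐᵒᵖ (RightCosets H) := by
  refine ⟨fun {a b} h => ?_⟩
  obtain ⟨a, rfl⟩ := MulOpposite.op_surjective a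
  obtain ⟨b, rfl⟩ := MulOpposite.op_surjective b
  have hmem : b * a⁻¹ ∈ H.normalCore := by
    intro x
    have := h (RightCosets.mk H x)
    rw [RightCosets.op_smul_mk, RightCosets.op_smul_mk, RightCosets.mk_eq_iff] at this
    simpa [mul_assoc] using this
  rw [hcore, Subgroup.mem_bot, mul_inv_eq_one] at hmem
  rw [hmem]

/-- Data on `(G, H, g)` with `H = K E`, where `K` is normalized by the involution `g` and acts
transitively by conjugation on the nontrivial elements of `E`. -/
structure IsAffineAmalgam {G : Type*} [Group G] (H E K : Subgroup G) (g : G) : Prop where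
  left_le : E ≤ H
  right_le : K ≤ H
  exists_mul : ∀ h ∈ H, ∃ k ∈ K, ∃ e ∈ E, h = k * e
  transitive : ∀ x ∈ E, ∀ y ∈ E, x ≠ 1 → y ≠ 1 → ∃ k ∈ K, k⁻¹ * x * k = y
  conj_mem : ∀ k ∈ K, g * k * g⁻¹ ∈ K
  mul_self : g * g = 1
  not_normalizes : ¬ ∀ h ∈ H, g * h * g⁻¹ ∈ H

namespace IsAffineAmalgam

variable {G : Type*} [Group G] {H E K : Subgroup G} {g : G}

/-- All-or-nothing: `g` normalizes `K`, so a single nontrivial `e` with `g e g⁻¹ ∈ H` carries its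
whole `K`-orbit `E \ {1}` into `H`, and then `g` would normalize `H = KE`. -/
theorem eq_one_of_conj_mem (hA : IsAffineAmalgam H E K g) {e : G} (he : e ∈ E)
    (hge : g * e * g⁻¹ ∈ H) : e = 1 := by
  by_contra hne
  refine hA.not_normalizes fun h hh => ?_
  obtain ⟨k, hk, e', he', rfl⟩ := hA.exists_mul h hh
  have hk' := hA.right_le (hA.conj_mem k hk)
  suffices hs : g * e' * g⁻¹ ∈ H by
    have := H.mul_mem hk' hs
    rwa [show g * k * g⁻¹ * (g * e' * g⁻¹) = g * (k * e') * g⁻¹ by group] at this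
  by_cases he1 : e' = 1
  · simp [he1]
  · obtain ⟨l, hl, rfl⟩ := hA.transitive e he e' he' hne he1
    have hl' := hA.right_le (hA.conj_mem l hl)
    have := H.mul_mem (H.mul_mem (H.inv_mem hl') hge) hl'
    rwa [show (g * l * g⁻¹)⁻¹ * (g * e * g⁻¹) * (g * l * g⁻¹) = g * (l⁻¹ * e * l) * g⁻¹ by
      group] at this

theorem isCosetGraphElement (hA : IsAffineAmalgam H E K g) : IsCosetGraphElement H g where
  two_element := (Nat.dvd_prime_pow Nat.prime_two).1
    (orderOf_dvd_of_pow_eq_one (n := 2 ^ 1) (by simpa [sq] using hA.mul_self)) |>.imp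
      fun _ h => h.2
  notMem := fun hg => hA.not_normalizes fun _ hh => H.mul_mem (H.mul_mem hg hh) (H.inv_mem hg)
  sq_mem := by rw [sq, hA.mul_self]; exact H.one_mem

/-- `HgH = HgKE = HgE`, since `gK = Kg` and `K ≤ H`. -/
theorem adj_iff (hA : IsAffineAmalgam H E K g) (hg : IsCosetGraphElement H g) (x y : G) :
    (cosetGraph H g hg).Adj (RightCosets.mk H x) (RightCosets.mk H y) ↔
      ∃ e ∈ E, RightCosets.mk H (g * e * x) = RightCosets.mk H y := by
  rw [cosetGraph_adj]
  constructor
  · intro h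
    obtain ⟨a, ha, d, hd, h⟩ := DoubleCoset.mem_doubleCoset.1 h
    obtain ⟨k, hk, e, he, rfl⟩ := hA.exists_mul d hd
    refine ⟨e, he, RightCosets.mk_eq_iff.2 ?_⟩
    have : y * (g * e * x)⁻¹ = a * (g * k * g⁻¹) := by
      calc y * (g * e * x)⁻¹ = y * x⁻¹ * (g * e)⁻¹ := by group
        _ = a * g * (k * e) * (g * e)⁻¹ := by rw [h]
        _ = a * (g * k * g⁻¹) := by group
    rw [this]
    exact H.mul_mem ha (hA.right_le (hA.conj_mem k hk))
  · rintro ⟨e, he, h⟩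
    rw [RightCosets.mk_eq_iff] at h
    exact DoubleCoset.mem_doubleCoset.2 ⟨_, h, e, hA.left_le he, by group⟩

theorem mk_injOn (hA : IsAffineAmalgam H E K g) {e e' : G} (he : e ∈ E) (he' : e' ∈ E) {x : G}
    (h : RightCosets.mk H (g * e * x) = RightCosets.mk H (g * e' * x)) : e = e' := by
  rw [RightCosets.mk_eq_iff] at h
  have := hA.eq_one_of_conj_mem (E.mul_mem he' (E.inv_mem he)) (by convert h using 1; group)
  exact (mul_inv_eq_one.1 this).symm

theorem ncard_neighborSet (hA : IsAffineAmalgam H E K g) (hg : IsCosetGraphElement H g)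
    (v : RightCosets H) : ((cosetGraph H g hg).neighborSet v).ncard = Nat.card E := by
  induction v using RightCosets.ind with | h x => ?_
  have : (cosetGraph H g hg).neighborSet (RightCosets.mk H x) =
      Set.range fun e : E => RightCosets.mk H (g * e * x) := by
    ext w
    induction w using RightCosets.ind with | h y => ?_
    rw [SimpleGraph.mem_neighborSet, hA.adj_iff hg]
    simp
  rw [this, ← Set.image_univ, Set.ncard_image_of_injective _ fun e e' h =>
    Subtype.ext (hA.mk_injOn e.2 e'.2 h), Set.ncard_univ]

/-- Every 2-arc is a translate of the standard one `(Hg, H, Hgz)`: `E` moves the first neighbour to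
`Hg`, after which `K`, which fixes both `H` and `Hg`, moves the last vertex. -/
theorem exists_smul_twoArc (hA : IsAffineAmalgam H E K g) (hg : IsCosetGraphElement H g) {z : G}
    (hz : z ∈ E) (hz1 : z ≠ 1) {u v w : RightCosets H}
    (h : IsTwoArc (cosetGraph H g hg) u v w) :
    ∃ a : Gᵐᵒᵖ, a • RightCosets.mk H g = u ∧ a • RightCosets.mk H 1 = v ∧
      a • RightCosets.mk H (g * z) = w := by
  induction u using RightCosets.ind with | h x => ?_
  induction v using RightCosets.ind with | h y => ?_
  induction w using RightCosets.ind with | h w => ?_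
  obtain ⟨-, -, huw, huv, hvw⟩ := h
  obtain ⟨e, he, hx⟩ := (hA.adj_iff hg y x).1 huv.symm
  obtain ⟨d, hd, hw⟩ := (hA.adj_iff hg y w).1 hvw
  have hde : d * e⁻¹ ≠ 1 := fun h => huw (by rw [← hx, ← hw, mul_inv_eq_one.1 h])
  obtain ⟨k, hk, hkz⟩ := hA.transitive z hz _ (E.mul_mem hd (E.inv_mem he)) hz1 hde
  -- `Hgk = H(gkg⁻¹)g = Hg`: this is why `k` does not disturb the vertex `Hg`.
  have hgk := H.inv_mem (hA.right_le (hA.conj_mem k hk))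
  have hd' : d = k⁻¹ * z * k * e := by rw [hkz]; group
  refine ⟨MulOpposite.op (k * e * y), ?_, ?_, ?_⟩
  · rw [RightCosets.op_smul_mk, ← hx, ← RightCosets.mk_mul_eq hgk]
    congr 1; group
  · rw [RightCosets.op_smul_mk, one_mul]
    exact RightCosets.mk_mul_eq (H.mul_mem (hA.right_le hk) (hA.left_le he)) y
  · rw [RightCosets.op_smul_mk, ← hw, ← RightCosets.mk_mul_eq hgk, hd']
    congr 1; group

theorem isTwoArcTransitive (hA : IsAffineAmalgam H E K g) (hg : IsCosetGraphElement H g)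
    (hcore : H.normalCore = ⊥) (hE : E ≠ ⊥) :
    IsTwoArcTransitive Gᵐᵒᵖ (cosetGraph H g hg) where
  faithful := RightCosets.faithfulSMul H hcore
  adj_iff := cosetGraph_adj_smul H g hg
  transitive := by
    obtain ⟨z, hz, hz1⟩ := E.bot_or_exists_ne_one.resolve_left hE
    intro u v w u' v' w' h h'
    obtain ⟨a, rfl, rfl, rfl⟩ := hA.exists_smul_twoArc hg hz hz1 h
    obtain ⟨a', rfl, rfl, rfl⟩ := hA.exists_smul_twoArc hg hz hz1 h'
    exact ⟨a' * a⁻¹, by simp [mul_smul], by simp [mul_smul], by simp [mul_smul]⟩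

end IsAffineAmalgam


/-! ### Almost simple groups and subdirect subgroups of their powers -/

instance socle_normal (A : Type*) [Group A] : (socle A).Normal :=
  Subgroup.sSup_normal _ fun _ hM => hM.1

theorem exists_isMinimalNormal_le {A : Type*} [Group A] [Finite A] (N : Subgroup A)
    [hN : N.Normal] (hN1 : N ≠ ⊥) : ∃ M ≤ N, IsMinimalNormal M := by
  obtain ⟨M, ⟨hM, hM1, hMN⟩, hmin⟩ :=
    (wellFounded_lt (α := Subgroup A)).has_min {M | M.Normal ∧ M ≠ ⊥ ∧ M ≤ N} ⟨N, hN, hN1, le_rfl⟩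
  exact ⟨M, hMN, hM, hM1, fun K hK hK1 hKM => by
    by_contra hne
    exact hmin K ⟨hK, hK1, hKM.trans hMN⟩ (lt_of_le_of_ne hKM hne)⟩

/-- A minimal normal subgroup inside `N` lies in the simple socle and is normal there, so it is the
whole socle. -/
theorem IsAlmostSimple.socle_le {A : Type*} [Group A] [Finite A] (hA : IsAlmostSimple A)
    (N : Subgroup A) [N.Normal] (hN1 : N ≠ ⊥) : socle A ≤ N := by
  obtain ⟨M, hMN, hM⟩ := exists_isMinimalNormal_le N hN1
  have hle : M ≤ socle A := le_sSup hM
  have := hA.1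
  rcases IsSimpleGroup.eq_bot_or_eq_top_of_normal _ (hM.1.subgroupOf (socle A)) with h | h
  · rw [Subgroup.subgroupOf_eq_bot, disjoint_of_le_iff_left_eq_bot hle] at h
    exact absurd h hM.2.1
  · exact (Subgroup.subgroupOf_eq_top.1 h).trans hMN

theorem mul_mul_inv_mul_inv_mem_of_index_le_two {A : Type*} [Group A] [Finite A] {T : Subgroup A}
    (hT : T.index ≤ 2) (x y : A) : x * y * x⁻¹ * y⁻¹ ∈ T := by
  have h0 : T.index ≠ 0 := Subgroup.index_ne_zero_of_finite
  rcases (show T.index = 1 ∨ T.index = 2 by omega) with h | h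
  · rw [Subgroup.index_eq_one.1 h]; trivial
  · simp only [Subgroup.mul_mem_iff_of_index_two h, inv_mem_iff]
    tauto

section Subdirect

variable {X ι : Type*} [Group X] [Finite X]

/-- Since `M` projects onto `X` at `j`, the image of `K` there is normal in `X`; being nontrivial,
it contains the socle. -/
theorem IsAlmostSimple.socle_le_map_eval (hX : IsAlmostSimple X) {M K : Subgroup (ι → X)}
    (hK : ∀ m ∈ M, ∀ k ∈ K, m * k * m⁻¹ ∈ K) {j : ι}
    (hM : ∀ x, ∃ m ∈ M, m j = x) {k : ι → X} (hk : k ∈ K) (hk1 : k j ≠ 1) {x : X}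
    (hx : x ∈ socle X) : ∃ m ∈ K, m j = x := by
  have hn : (K.map (Pi.evalMonoidHom (fun _ : ι => X) j)).Normal := by
    refine ⟨?_⟩
    rintro _ ⟨l, hl, rfl⟩ g
    obtain ⟨m, hm, rfl⟩ := hM g
    exact ⟨_, hK m hm l hl, rfl⟩
  obtain ⟨m, hm, h⟩ := hX.socle_le (K.map (Pi.evalMonoidHom (fun _ : ι => X) j)) (fun h => hk1 ((Subgroup.eq_bot_iff_forall _).1 h _
    ⟨k, hk, rfl⟩)) hx
  exact ⟨m, hm, h⟩

/-- A subdirect subgroup of a power of an almost simple group that separates the coordinates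
contains the corresponding power of the socle. -/
theorem IsAlmostSimple.pi_socle_le [Fintype ι] (hX : IsAlmostSimple X)
    {M : Subgroup (ι → X)} (hM : ∀ j x, ∃ m ∈ M, m j = x)
    (hsep : ∀ i j, i ≠ j → ∃ m ∈ M, m i = 1 ∧ m j ≠ 1) :
    (Subgroup.pi Set.univ fun _ : ι => socle X) ≤ M := by
  classical
  obtain ⟨-, u, hu, v, hv, huv⟩ := id hX
  -- The elements of `M` trivial on `S` are normalized by `M`, so one nontrivial value at `j` yields
  -- all of the socle.
  have step : ∀ (S : Set ι) (j : ι), (∃ m ∈ M, (∀ i ∈ S, m i = 1) ∧ m j ≠ 1) →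
      ∀ x ∈ socle X, ∃ m ∈ M, (∀ i ∈ S, m i = 1) ∧ m j = x := by
    rintro S j ⟨m, hm, hmS, hmj⟩ x hx
    have := hX.socle_le_map_eval (M := M)
      (K := M ⊓ Subgroup.pi S fun _ => ⊥) (j := j) ?_ (hM j) (k := m)
      ⟨hm, fun i hi => hmS i hi⟩ hmj hx
    · obtain ⟨l, ⟨hl, hlS⟩, hlj⟩ := this
      exact ⟨l, hl, fun i hi => hlS i hi, hlj⟩
    · rintro m hm k ⟨hk, hkS⟩
      refine ⟨M.mul_mem (M.mul_mem hm hk) (M.inv_mem hm), fun i hi => ?_⟩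
      have : k i = 1 := hkS i hi
      simp [this]
  have key : ∀ (j : ι) (S : Finset ι), j ∉ S →
      ∀ x ∈ socle X, ∃ m ∈ M, (∀ i ∈ S, m i = 1) ∧ m j = x := by
    intro j S
    induction S using Finset.induction_on with
    | empty =>
      intro _ x _
      obtain ⟨m, hm, h⟩ := hM j x
      exact ⟨m, hm, by simp, h⟩
    | insert i S _ ih =>
      intro hj
      rw [Finset.mem_insert, not_or] at hj
      obtain ⟨m, hm, hmS, rfl⟩ := ih hj.2 u hu
      obtain ⟨l, hl, hli, hlj⟩ := hsep i j (Ne.symm hj.1)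
      obtain ⟨l, hl, hli, rfl⟩ := step {i} j ⟨l, hl, by simpa using hli, hlj⟩ v hv
      -- The commutator is trivial wherever either factor is, hence on `S` and at `i`, while its
      -- value at `j` is `[u, v] ≠ 1`.
      refine step (↑(insert i S) : Set ι) j ⟨m * l * m⁻¹ * l⁻¹,
        M.mul_mem (M.mul_mem (M.mul_mem hm hl) (M.inv_mem hm)) (M.inv_mem hl), ?_, ?_⟩
      · intro k hk
        rcases Finset.mem_insert.1 hk with rfl | hk
        · simp [hli k rfl]
        · simp [hmS k hk]
      · intro h
        refine huv ?_
        simp only [Pi.mul_apply, Pi.inv_apply] at h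
        rw [mul_inv_eq_one, mul_inv_eq_iff_eq_mul] at h
        exact h
  intro x hx
  have hsingle : ∀ j, Pi.mulSingle j (x j) ∈ M := by
    intro j
    obtain ⟨m, hm, h1, h2⟩ := key j (Finset.univ.erase j) (by simp) (x j) (hx j trivial)
    convert hm
    funext i
    by_cases hij : i = j
    · subst hij; simp [h2]
    · rw [Pi.mulSingle_eq_of_ne hij, h1 i (by simp [hij])]
  exact Subgroup.pi_mem_of_mulSingle_mem x hsingle

/-- A subgroup normalized by a subdirect group is trivial if its commutators
lie in a power of an abelian group. -/
theorem IsAlmostSimple.eq_one_of_commutators_mem (hX : IsAlmostSimple X)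
    {M N : Subgroup (ι → X)} (hM : ∀ j x, ∃ m ∈ M, m j = x)
    (hN : ∀ m ∈ M, ∀ k ∈ N, m * k * m⁻¹ ∈ N) {F : Subgroup X}
    (hF : ∀ x ∈ F, ∀ y ∈ F, Commute x y)
    (hNF : ∀ x ∈ N, ∀ y ∈ N, ∀ i, (x * y * x⁻¹ * y⁻¹) i ∈ F) {x : ι → X} (hx : x ∈ N) :
    x = 1 := by
  by_contra hx1
  obtain ⟨j, hj⟩ := Function.ne_iff.1 hx1
  have hT := fun {t} (ht : t ∈ socle X) => hX.socle_le_map_eval hN (hM j) hx hj ht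
  have hcomm : ∀ y ∈ socle X, ∀ z ∈ socle X, y * z * y⁻¹ * z⁻¹ ∈ F := by
    intro y hy z hz
    obtain ⟨y, hy', rfl⟩ := hT hy
    obtain ⟨z, hz', rfl⟩ := hT hz
    exact hNF y hy' z hz' j
  obtain ⟨-, u, hu, v, hv, huv⟩ := id hX
  -- The derived subgroup of the socle is normal in `X` and nontrivial, so the socle is perfect.
  have hle : socle X ≤ ⁅socle X, socle X⁆ := by
    refine hX.socle_le _ fun h => huv ?_
    have := (Subgroup.eq_bot_iff_forall _).1 h _ (Subgroup.commutator_mem_commutator hu hv)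
    exact commutatorElement_eq_one_iff_commute.1 this
  have hle' : ⁅socle X, socle X⁆ ≤ F :=
    Subgroup.commutator_le.2 fun y hy z hz => hcomm y hy z hz
  exact huv (hF u (hle' (hle hu)) v (hle' (hle hv)))

end Subdirect


/-! ### Products of a subgroup with a normalizing one -/

section Products

variable {G : Type*} [Group G] {E K : Subgroup G}

theorem commute_of_mem_zpowers {a x y : G} (hx : x ∈ Subgroup.zpowers a)
    (hy : y ∈ Subgroup.zpowers a) : Commute x y := by
  obtain ⟨i, rfl⟩ := hx
  obtain ⟨j, rfl⟩ := hy
  exact Commute.zpow_zpow_self a i j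

theorem exists_mul_of_mem_sup (hn : ∀ k ∈ K, ∀ e ∈ E, k * e * k⁻¹ ∈ E) {h : G}
    (hh : h ∈ E ⊔ K) : ∃ k ∈ K, ∃ e ∈ E, h = k * e := by
  let S : Subgroup G :=
    { carrier := {h | ∃ k ∈ K, ∃ e ∈ E, h = k * e}
      one_mem' := ⟨1, K.one_mem, 1, E.one_mem, by simp⟩
      mul_mem' := by
        rintro _ _ ⟨k, hk, e, he, rfl⟩ ⟨l, hl, d, hd, rfl⟩
        have := hn _ (K.inv_mem hl) _ he
        exact ⟨k * l, K.mul_mem hk hl, _, E.mul_mem this hd, by group⟩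
      inv_mem' := by
        rintro _ ⟨k, hk, e, he, rfl⟩
        exact ⟨k⁻¹, K.inv_mem hk, _, hn _ hk _ (E.inv_mem he), by group⟩ }
  exact (sup_le (fun e he => ⟨1, K.one_mem, e, he, by simp⟩)
    (fun k hk => ⟨k, hk, 1, E.one_mem, by simp⟩) : E ⊔ K ≤ S) hh

/-- `EK/E` is a quotient of the abelian group `K`; the identity below makes this explicit. -/
theorem commutator_mem_of_mem_sup (hn : ∀ k ∈ K, ∀ e ∈ E, k * e * k⁻¹ ∈ E)
    (hK : ∀ k ∈ K, ∀ l ∈ K, Commute k l) {x y : G} (hx : x ∈ E ⊔ K) (hy : y ∈ E ⊔ K) :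
    x * y * x⁻¹ * y⁻¹ ∈ E := by
  obtain ⟨k, hk, e, he, rfl⟩ := exists_mul_of_mem_sup hn hx
  obtain ⟨l, hl, d, hd, rfl⟩ := exists_mul_of_mem_sup hn hy
  have hkl : k⁻¹ * l = l * k⁻¹ := (hK _ (K.inv_mem hk) _ hl).eq
  have : k * e * (l * d) * (k * e)⁻¹ * (l * d)⁻¹ =
      (k * e * k⁻¹) * (k * l * (d * e⁻¹) * (k * l)⁻¹) * (l * d⁻¹ * l⁻¹) := by
    calc _ = k * e * l * d * e⁻¹ * l⁻¹ * (l * k⁻¹) * d⁻¹ * l⁻¹ := by group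
      _ = k * e * l * d * e⁻¹ * l⁻¹ * (k⁻¹ * l) * d⁻¹ * l⁻¹ := by rw [hkl]
      _ = _ := by group
  rw [this]
  exact E.mul_mem (E.mul_mem (hn _ hk _ he)
    (hn _ (K.mul_mem hk hl) _ (E.mul_mem hd (E.inv_mem he)))) (hn _ hl _ (E.inv_mem hd))

/-- `⟨θ⟩` acts on `E` through `⟨θ⟩/⟨θⁿ⟩`, so an orbit has at most `n` elements; the extra `1` is the
identity. -/
theorem card_le_of_transitive_of_commute_pow {θ : G} {n : ℕ} (hn : 0 < n)
    (htrans : ∀ x ∈ E, ∀ y ∈ E, x ≠ 1 → y ≠ 1 → ∃ k ∈ Subgroup.zpowers θ, k⁻¹ * x * k = y)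
    (hcomm : ∀ x ∈ E, Commute (θ ^ n) x) : Nat.card E ≤ n + 1 := by
  classical
  by_cases hE : E = ⊥
  · simp [hE]
  obtain ⟨x, hx, hx1⟩ := E.bot_or_exists_ne_one.resolve_left hE
  let S : Finset G := insert 1 ((Finset.range n).image fun k => (θ ^ k)⁻¹ * x * θ ^ k)
  have hES : (E : Set G) ⊆ S := by
    intro y hy
    by_cases hy1 : y = 1
    · simp [S, hy1]
    obtain ⟨_, ⟨z, rfl⟩, rfl⟩ := htrans x hx y hy hx1 hy1
    have hn' : (n : ℤ) ≠ 0 := by exact_mod_cast hn.ne'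
    obtain ⟨k, hk⟩ := Int.eq_ofNat_of_zero_le (Int.emod_nonneg z hn')
    have hkn : k < n := by
      have := Int.emod_lt_of_pos z (show (0 : ℤ) < n by exact_mod_cast hn)
      omega
    have hk' : z % n = (k : ℤ) := hk
    have hz : θ ^ z = (θ ^ n) ^ (z / n) * θ ^ k := by
      rw [← zpow_natCast, ← zpow_natCast, ← zpow_mul, ← zpow_add, ← hk',
        Int.mul_ediv_add_emod]
    have hc : ((θ ^ n) ^ (z / n))⁻¹ * x * (θ ^ n) ^ (z / n) = x := by
      rw [mul_assoc, ← ((hcomm x hx).zpow_left _).eq, inv_mul_cancel_left]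
    have : (θ ^ z)⁻¹ * x * θ ^ z = (θ ^ k)⁻¹ * x * θ ^ k := by
      calc _ = (θ ^ k)⁻¹ * (((θ ^ n) ^ (z / n))⁻¹ * x * (θ ^ n) ^ (z / n)) * θ ^ k := by
            rw [hz]; group
        _ = _ := by rw [hc]
    simp only [S, Finset.coe_insert, Finset.coe_image]
    exact Or.inr ⟨k, by simpa using hkn, this.symm⟩
  calc Nat.card E = (E : Set G).ncard := rfl
    _ ≤ (S : Set G).ncard := Set.ncard_le_ncard hES
    _ = S.card := Set.ncard_coe_finset S
    _ ≤ n + 1 := (Finset.card_insert_le _ _).trans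
      (Nat.succ_le_succ (Finset.card_image_le.trans (by simp)))

theorem normal_of_closure_eq_top {H : Subgroup G} {g : G} (hg : g * g = 1)
    (hH : ∀ h ∈ H, g * h * g⁻¹ ∈ H) (hgen : Subgroup.closure ((H : Set G) ∪ {g}) = ⊤) :
    H.Normal := by
  rw [← Subgroup.normalizer_eq_top_iff, eq_top_iff, ← hgen, Subgroup.closure_le]
  rintro x (hx | rfl)
  · exact Subgroup.le_normalizer hx
  · refine Subgroup.mem_normalizer_iff.2 fun h => ⟨hH h, fun hh => ?_⟩
    have := hH _ hh
    rwa [show x * (x * h * x⁻¹) * x⁻¹ = (x * x) * h * (x * x)⁻¹ by group, hg, one_mul, inv_one,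
      mul_one] at this

end Products

/-! ### The complement `⟨b, c⟩` -/

section Complement

variable {X : Type*} [Group X] {b c : X}

theorem odd_div_gcd {q : ℕ} (hq : 1 < q) (h : Even q ∨ 4 ∣ q + 1) :
    Odd ((q - 1) / Nat.gcd 2 (q - 1)) := by
  rcases Nat.even_or_odd q with he | ho
  · have : Nat.gcd 2 (q - 1) = 1 := by
      rw [← Nat.coprime_iff_gcd_eq_one, Nat.coprime_two_left]
      exact Nat.Even.sub_odd hq.le he odd_one
    rw [this, Nat.div_one]
    exact Nat.Even.sub_odd hq.le he odd_one
  · have h4 := h.resolve_left (Nat.not_even_iff_odd.2 ho)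
    have : Nat.gcd 2 (q - 1) = 2 := Nat.gcd_eq_left (by obtain ⟨k, rfl⟩ := ho; omega)
    rw [this, Nat.odd_iff]
    omega

/-- Both orders divide `q - 1`, so exponents reduce by `q + 1 ≡ 2` and `q ≡ 1`. -/
theorem pow_mul_pow_eq_sq_mul {q : ℕ} (hq : 1 < q)
    (hb : orderOf b = (q - 1) / Nat.gcd 2 (q - 1)) (hc : orderOf c = Nat.gcd 2 (q - 1)) :
    b ^ (q + 1) * c ^ q = b ^ 2 * c := by
  have hb1 : b ^ (q - 1) = 1 := orderOf_dvd_iff_pow_eq_one.1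
    (hb ▸ Nat.div_dvd_of_dvd (Nat.gcd_dvd_right _ _))
  have hc1 : c ^ (q - 1) = 1 := orderOf_dvd_iff_pow_eq_one.1 (hc ▸ Nat.gcd_dvd_right _ _)
  have h1 : b ^ (q + 1) = b ^ 2 := by
    rw [show q + 1 = q - 1 + 2 by omega, pow_add, hb1, one_mul]
  have h2 : c ^ q = c := by
    conv_lhs => rw [show q = q - 1 + 1 by omega, pow_succ, hc1, one_mul]
  rw [h1, h2]

/-- The odd power `m` kills `b²` and fixes `c`; then `b²` is recovered, and squaring is invertible
on `⟨b⟩`. -/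
theorem mem_zpowers_sq_mul (hbc : Commute b c) {m : ℕ} (hm : Odd m) (hb : b ^ m = 1)
    (hc : c ^ 2 = 1) : b ∈ Subgroup.zpowers (b ^ 2 * c) ∧ c ∈ Subgroup.zpowers (b ^ 2 * c) := by
  obtain ⟨k, rfl⟩ := hm
  have hcm : c ^ (2 * k + 1) = c := by rw [pow_succ, pow_mul, hc, one_pow, one_mul]
  have hcmem : c ∈ Subgroup.zpowers (b ^ 2 * c) := by
    refine ⟨(2 * k + 1 : ℕ), ?_⟩
    simp only [zpow_natCast]
    rw [(hbc.pow_left 2).mul_pow, ← pow_mul, mul_comm 2, pow_mul, hb, one_pow, one_mul, hcm]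
  refine ⟨?_, hcmem⟩
  have hb2 : b ^ 2 ∈ Subgroup.zpowers (b ^ 2 * c) := by
    have := mul_mem (Subgroup.mem_zpowers (b ^ 2 * c)) (inv_mem hcmem)
    rwa [mul_inv_cancel_right] at this
  have := pow_mem hb2 (k + 1)
  have hb' : (b ^ 2) ^ (k + 1) = b := by
    rw [← pow_mul, show 2 * (k + 1) = 2 * k + 1 + 1 by ring, pow_succ, hb, one_mul]
  rwa [hb'] at this

/-- An element normalizing `⟨b⟩ × ⟨c⟩`, with `b` of odd order and `c` of order at most `2`,
centralizes `c`. -/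
theorem conj_eq_of_mem_normalizer (hbc : Commute b c) {m : ℕ} (hm : Odd m) (hb : b ^ m = 1)
    (hc : c ^ 2 = 1) {o : X} (ho : o * c * o⁻¹ ∈ Subgroup.zpowers (b ^ 2 * c)) :
    o * c * o⁻¹ = c := by
  obtain ⟨k, rfl⟩ := hm
  obtain ⟨z, hz⟩ := ho
  simp only at hz
  have hcm : c ^ (2 * k + 1) = c := by rw [pow_succ, pow_mul, hc, one_pow, one_mul]
  have ham : (b ^ 2 * c) ^ (2 * k + 1) = c := by
    rw [(hbc.pow_left 2).mul_pow, ← pow_mul, mul_comm 2, pow_mul, hb, one_pow, one_mul, hcm]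
  have h : o * c * o⁻¹ = c ^ z := by
    calc o * c * o⁻¹ = (o * c * o⁻¹) ^ (2 * k + 1) := by rw [conj_pow, hcm]
      _ = c ^ z := by rw [← hz, ← zpow_natCast, zpow_comm, zpow_natCast, ham]
  -- For even `z` the conjugate is trivial, hence so is `c`; for odd `z`, `c ^ z = c`.
  rcases Int.even_or_odd' z with ⟨w, rfl | rfl⟩
  · have hc' : c ^ (2 : ℤ) = 1 := by exact_mod_cast hc
    rw [zpow_mul, hc', one_zpow, conj_eq_one_iff] at h
    simp [h]
  · have hc' : c ^ (2 : ℤ) = 1 := by exact_mod_cast hc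
    rwa [zpow_add, zpow_mul, hc', one_zpow, one_mul, zpow_one] at h

end Complement

/-! ### The wreath product -/

section WreathProduct

variable {X : Type*} [Group X] {n : ℕ}

theorem base_conj (w : Wreath X n) (x : Fin n → X) :
    w * base X n x * w⁻¹ = base X n (fun i => w.left i * x (w.right.1 i) * (w.left i)⁻¹) := by
  have h : w = base X n w.left * SemidirectProduct.inr w.right :=
    (SemidirectProduct.inl_left_mul_inr_right w).symm
  have h2 := SemidirectProduct.inl_aut (φ := rotAction X n) w.right x
  calc w * base X n x * w⁻¹ = base X n w.left *
        (SemidirectProduct.inr w.right * base X n x * SemidirectProduct.inr w.right⁻¹) *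
          (base X n w.left)⁻¹ := by
        rw [map_inv]; conv_lhs => rw [h]
        group
    _ = _ := by
      rw [← h2, ← map_inv, ← map_mul, ← map_mul]
      rfl

theorem conj_mem_range_base (w : Wreath X n) {v : Wreath X n} (hv : v ∈ (base X n).range) :
    w * v * w⁻¹ ∈ (base X n).range := by
  obtain ⟨x, rfl⟩ := hv
  exact ⟨_, (base_conj w x).symm⟩

theorem base_injective : Function.Injective (base X n) := SemidirectProduct.inl_injective

theorem base_mem_map {Y : Subgroup (Fin n → X)} {x : Fin n → X} :
    base X n x ∈ Y.map (base X n) ↔ x ∈ Y :=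
  Subgroup.mem_map_iff_mem base_injective

theorem base_mem_power {Y : Subgroup X} {x : Fin n → X} :
    base X n x ∈ power n Y ↔ ∀ i, x i ∈ Y := by
  rw [power, base_mem_map, Subgroup.mem_pi]
  simp

theorem power_conj_mem {Y : Subgroup X} [hY : Y.Normal] (w : Wreath X n) {v : Wreath X n}
    (hv : v ∈ power n Y) : w * v * w⁻¹ ∈ power n Y := by
  obtain ⟨x, hx, rfl⟩ := hv
  rw [base_conj, base_mem_power]
  exact fun i => hY.conj_mem _ (hx _ trivial) _

theorem tau_pow (k : ℕ) : tau X n ^ k =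
    SemidirectProduct.inr ((⟨finRotate n, Subgroup.mem_zpowers _⟩ : Rot n) ^ k) := by
  rw [tau, map_pow]

/-- The exponent of `c` at `i` counts how many of the first `k` points on the rotation orbit of `i`
avoid the exceptional coordinate. -/
theorem theta_pow {b c : X} (hbc : Commute b c) (k : ℕ) :
    theta n b c ^ k = base X n (fun i => b ^ k * c ^ (∑ j ∈ Finset.range k,
      if ((finRotate n ^ j) i).val = 1 then 0 else 1)) * tau X n ^ k := by
  induction k with
  | zero => simp; rfl
  | succ k ih =>
    rw [pow_succ', ih, theta]
    have h := base_conj (tau X n) (fun i => b ^ k * c ^ (∑ j ∈ Finset.range k,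
      if ((finRotate n ^ j) i).val = 1 then 0 else 1))
    rw [mul_inv_eq_iff_eq_mul] at h
    rw [mul_assoc, ← mul_assoc (tau X n), h, pow_succ' (tau X n), mul_assoc, ← mul_assoc, ← map_mul]
    congr 2
    funext i
    have hd : dZero n b c i = b * c ^ (if i.val = 1 then 0 else 1) := by
      rw [dZero]; split_ifs <;> simp
    have hl : (tau X n).left i = 1 := rfl
    have hr : (tau X n).right.1 i = finRotate n i := rfl
    have hs : (∑ j ∈ Finset.range (k + 1), if ((finRotate n ^ j) i).val = 1 then 0 else 1) =
        (if i.val = 1 then 0 else 1) + ∑ j ∈ Finset.range k,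
          if ((finRotate n ^ j) (finRotate n i)).val = 1 then 0 else 1 := by
      rw [Finset.sum_range_succ', add_comm]
      simp [pow_succ]
    rw [Pi.mul_apply, hd, hl, hr, hs, pow_succ', pow_add, one_mul, inv_one, mul_one, mul_assoc b,
      ← mul_assoc (c ^ _), ← (hbc.pow_pow k _).eq]
    simp only [mul_assoc]

/-- A full turn meets the exceptional coordinate exactly once, whatever the start, so the tuple is
constant with `c`-exponent `q`. -/
theorem theta_pow_card {b c : X} (hbc : Commute b c) {q : ℕ} (hq : 1 ≤ q) :
    theta (q + 1) b c ^ (q + 1) = base X (q + 1) (fun _ => b ^ (q + 1) * c ^ q) := by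
  have hrot : ∀ (j : ℕ) (i : Fin (q + 1)), (finRotate (q + 1) ^ j) i = i + Fin.ofNat (q + 1) j := by
    intro j i
    induction j with
    | zero => exact (add_zero i).symm
    | succ j ih =>
      rw [pow_succ', Equiv.Perm.mul_apply, ih, finRotate_apply]
      exact Fin.ext (by simp [Fin.val_add, add_assoc])
  have htau : tau X (q + 1) ^ (q + 1) = 1 := by
    rw [tau_pow, ← map_one SemidirectProduct.inr]
    congr 1
    refine Subtype.ext (Equiv.ext fun i => ?_)
    rw [Subgroup.coe_pow, hrot]
    exact Fin.ext (by simp)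
  rw [theta_pow hbc, htau, mul_one]
  congr 1
  funext i
  congr 2
  have h1 : ∀ j : Fin (q + 1), j.val = 1 ↔ j = 1 := fun j => by
    rw [Fin.ext_iff, Fin.val_one', Nat.mod_eq_of_lt (by omega)]
  calc _ = ∑ j : Fin (q + 1), if i + j = 1 then 0 else 1 := by
        rw [Finset.sum_range]
        simp [hrot, h1]
    _ = ∑ j : Fin (q + 1), if j = 1 then 0 else 1 :=
        Equiv.sum_comp (Equiv.addLeft i) fun j => if j = 1 then 0 else 1
    _ = q := by
        rw [← Finset.sum_erase_add _ _ (Finset.mem_univ (1 : Fin (q + 1)))]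
        rw [Finset.sum_congr rfl fun j hj => if_neg (Finset.ne_of_mem_erase hj)]
        simp

/-- An element of the wreath product centralizing `T ^ n`, where `T ≠ 1`, lies in the base group. -/
theorem mem_range_base_of_commute {t : X} (ht : t ≠ 1) {w : Wreath X n}
    (hw : ∀ i, Commute w (base X n (Pi.mulSingle i t))) : w ∈ (base X n).range := by
  have hr : w.right = 1 := by
    refine Subtype.ext (Equiv.ext fun i => ?_)
    by_contra hne
    have h := base_conj w (Pi.mulSingle i t)
    rw [(hw i).eq, mul_inv_cancel_right] at h
    have := congrFun (base_injective h) i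
    simp only [Pi.mulSingle_eq_same] at this
    rw [Pi.mulSingle_eq_of_ne (show (w.right.1 i) ≠ i from hne)] at this
    exact ht (by simpa using this)
  refine ⟨w.left, SemidirectProduct.ext rfl hr.symm⟩

/-- A subgroup normalized by `T ^ n`, where `T ≠ 1`, is trivial if it meets the base group
trivially. -/
theorem eq_one_of_disjoint_base {T : Subgroup X} {t : X} (ht : t ∈ T) (ht1 : t ≠ 1)
    {N : Subgroup (Wreath X n)} (hN : ∀ l ∈ power n T, ∀ k ∈ N, l * k * l⁻¹ ∈ N)
    (hbase : ∀ x, base X n x ∈ N → x = 1) {w : Wreath X n} (hw : w ∈ N) : w = 1 := by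
  obtain ⟨x, rfl⟩ : w ∈ (base X n).range := by
    refine mem_range_base_of_commute ht1 fun i => ?_
    have hy : base X n (Pi.mulSingle i t) ∈ power n T := by
      refine base_mem_power.2 fun j => ?_
      by_cases hij : j = i
      · subst hij; simpa using ht
      · rw [Pi.mulSingle_eq_of_ne hij]; exact one_mem _
    -- The commutator of `w` with an element of `Tⁿ` lies both in `N` and in the base group, so it
    -- is trivial.
    obtain ⟨z, hz⟩ := mul_mem (conj_mem_range_base w ⟨Pi.mulSingle i t, rfl⟩)
      (inv_mem (MonoidHom.mem_range.2 ⟨Pi.mulSingle i t, rfl⟩))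
    have hzN : base X n z ∈ N := by
      have := mul_mem hw (hN _ hy _ (inv_mem hw))
      rw [hz]
      simpa only [mul_assoc] using this
    rw [hbase z hzN, map_one, eq_comm, mul_inv_eq_one, mul_inv_eq_iff_eq_mul] at hz
    exact hz
  rw [hbase x hw, map_one]

end WreathProduct


/-! ### The groups `G` and `H` -/

theorem card_elemAb (p k : ℕ) [Fact p.Prime] : Nat.card (ElemAb p k) = p ^ k := by
  rw [Nat.card_congr Multiplicative.toAdd]
  simp

section Admissible

variable {X : Type*} [Group X] {p f n : ℕ} {F T : Subgroup X} {b c o a : X}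
  {E : Subgroup (Fin n → X)}

theorem IsAdmissible.conj_mem (hE : IsAdmissible p f n F b c E) :
    ∀ k ∈ Subgroup.zpowers (theta n b c), ∀ e ∈ E.map (base X n),
      k * e * k⁻¹ ∈ E.map (base X n) := by
  obtain ⟨hle, hnormal, -⟩ := hE.minimal
  intro k hk e he
  exact (Subgroup.normal_subgroupOf_iff hle).1 hnormal e k he (Subgroup.mem_sup_right hk)

theorem IsAdmissible.apply_mem (hE : IsAdmissible p f n F b c E) {e : Fin n → X} (he : e ∈ E)
    (i : Fin n) : e i ∈ F :=
  hE.proj_eq i ▸ ⟨e, he, rfl⟩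

theorem IsAdmissible.card_eq [Fact p.Prime] (hE : IsAdmissible p f n F b c E) :
    Nat.card E = (p ^ f) ^ 2 := by
  obtain ⟨φ⟩ := hE.elemAb
  rw [Nat.card_congr φ.toEquiv, card_elemAb, ← pow_mul, mul_comm]

theorem card_map_base : Nat.card (E.map (base X n)) = Nat.card E :=
  Nat.card_congr (E.equivMapOfInjective _ base_injective).symm.toEquiv

theorem IsAdmissible.transitive_map (hE : IsAdmissible p f n F b c E) :
    ∀ x ∈ E.map (base X n), ∀ y ∈ E.map (base X n), x ≠ 1 → y ≠ 1 →
      ∃ k ∈ Subgroup.zpowers (theta n b c), k⁻¹ * x * k = y := by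
  rintro _ ⟨x, hx, rfl⟩ _ ⟨y, hy, rfl⟩ hx1 hy1
  exact hE.transitive x hx y hy (fun h => hx1 (by rw [h, map_one]))
    (fun h => hy1 (by rw [h, map_one]))

/-- All the kernels on `E` have the same order `|E|/|F|`, so distinct ones cannot be nested. -/
theorem IsAdmissible.exists_apply_eq_one [Finite X] (hE : IsAdmissible p f n F b c E)
    {i j : Fin n} (hij : i ≠ j) : ∃ e ∈ E, e i = 1 ∧ e j ≠ 1 := by
  by_contra! h
  have hrange : ∀ k : Fin n, ((proj X n k).comp E.subtype).range = F := fun k => by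
    rw [MonoidHom.range_comp, Subgroup.range_subtype, hE.proj_eq k]
  have hcard : ∀ k : Fin n,
      Nat.card ((proj X n k).comp E.subtype).ker * Nat.card F = Nat.card E := fun k => by
    rw [← hrange k, ← Subgroup.index_ker, Subgroup.card_mul_index]
  have hle : ((proj X n i).comp E.subtype).ker ≤ ((proj X n j).comp E.subtype).ker :=
    fun e he => h e e.2 he
  have heq := Subgroup.eq_of_le_of_card_ge hle
    (Nat.eq_of_mul_eq_mul_right Nat.card_pos ((hcard j).trans (hcard i).symm)).le
  refine hE.ker_ne i j hij ?_
  ext e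
  simp only [Subgroup.mem_inf, and_congr_left_iff]
  exact fun he => SetLike.ext_iff.1 heq ⟨e, he⟩

/-- By transitivity, `E ∩ Tⁿ` is `E` or trivial. In the second case `[E, θⁿ] ≤ E ∩ Tⁿ = 1`, as `X/T`
is abelian, and `E` is too large for that. -/
theorem IsAdmissible.le_pi [Finite X] (hE : IsAdmissible p f n F b c E) [hTn : T.Normal]
    (hT : T.index ≤ 2) (hn : 0 < n) (hcard : n + 1 < Nat.card E)
    (ha : theta n b c ^ n = base X n fun _ => a) {e : Fin n → X} (he : e ∈ E) (i : Fin n) :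
    e i ∈ T := by
  by_cases h : ∃ x ∈ E, x ≠ 1 ∧ ∀ i, x i ∈ T
  · obtain ⟨x, hx, hx1, hxT⟩ := h
    by_cases he1 : e = 1
    · rw [he1]; exact T.one_mem
    obtain ⟨g, -, hg⟩ := hE.transitive x hx e he hx1 he1
    have := power_conj_mem (g⁻¹) (base_mem_power.2 hxT)
    rw [inv_inv, hg, base_mem_power] at this
    exact this i
  · push Not at h
    refine absurd ?_ (not_le.2 hcard)
    rw [← card_map_base]
    refine card_le_of_transitive_of_commute_pow hn hE.transitive_map ?_
    rintro _ ⟨x, hx, rfl⟩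
    have hmem : (fun i => a * x i * a⁻¹ * (x i)⁻¹) ∈ E := by
      have := mul_mem (hE.conj_mem _ (pow_mem (Subgroup.mem_zpowers _) n) _
        (Subgroup.mem_map_of_mem _ hx)) (inv_mem (Subgroup.mem_map_of_mem (base X n) hx))
      rw [ha, ← map_inv, ← map_inv, ← map_mul, ← map_mul, ← map_mul, base_mem_map] at this
      exact this
    have h1 : (fun i => a * x i * a⁻¹ * (x i)⁻¹) = 1 := by
      by_contra hne
      obtain ⟨i, hi⟩ := h _ hmem hne
      exact hi (mul_mul_inv_mul_inv_mem_of_index_le_two hT _ _)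
    rw [ha, Commute, SemiconjBy, ← map_mul, ← map_mul]
    congr 1
    funext i
    have := congrFun h1 i
    simp only [Pi.one_apply] at this
    rw [mul_inv_eq_one, mul_inv_eq_iff_eq_mul] at this
    exact this

theorem groupH_le_groupG (hET : ∀ e ∈ E, ∀ i, e i ∈ T) : groupH n E b c ≤ groupG n T b c := by
  refine sup_le (le_trans ?_ le_sup_left) le_sup_right
  rintro _ ⟨e, he, rfl⟩
  exact base_mem_power.2 (hET e he)

/-- A subgroup containing `H` and `(o, …, o)` meets the base group in a subdirect subgroup. -/
theorem IsAdmissible.exists_apply_eq (hE : IsAdmissible p f n F b c E)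
    (ha : theta n b c ^ n = base X n fun _ => a)
    (hba : b ∈ Subgroup.zpowers a) (hca : c ∈ Subgroup.zpowers a)
    (hgen : Subgroup.closure ((F : Set X) ∪ {b, c, o}) = ⊤) {L : Subgroup (Wreath X n)}
    (hH : groupH n E b c ≤ L) (ho : diag n o ∈ L) (j : Fin n) (x : X) :
    ∃ m ∈ L.comap (base X n), m j = x := by
  suffices h : Subgroup.closure ((F : Set X) ∪ {b, c, o}) ≤
      (L.comap (base X n)).map (proj X n j) from h (hgen ▸ Subgroup.mem_top x)
  have haL : a ∈ (L.comap (base X n)).map (proj X n j) := by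
    refine ⟨fun _ => a, ?_, rfl⟩
    change base X n (fun _ => a) ∈ L
    rw [← ha]
    exact pow_mem (hH (Subgroup.mem_sup_right (Subgroup.mem_zpowers _))) n
  have haL' := Subgroup.zpowers_le.2 haL
  rw [Subgroup.closure_le]
  rintro y (hy | rfl | rfl | rfl)
  · obtain ⟨e, he, rfl⟩ := (hE.proj_eq j).symm ▸ hy
    exact ⟨e, hH (Subgroup.mem_sup_left ⟨e, he, rfl⟩), rfl⟩
  · exact haL' hba
  · exact haL' hca
  · exact ⟨fun _ => y, ho, rfl⟩

theorem IsAdmissible.groupG_le [Finite X] (hE : IsAdmissible p f n F b c E)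
    (hX : IsAlmostSimple X) {L : Subgroup (Wreath X n)} (hH : groupH n E b c ≤ L)
    (hL : ∀ j x, ∃ m ∈ L.comap (base X n), m j = x) : groupG n (socle X) b c ≤ L := by
  refine sup_le ?_ (le_sup_right.trans hH)
  refine Subgroup.map_le_iff_le_comap.2 (hX.pi_socle_le hL fun i j hij => ?_)
  obtain ⟨e, he, h⟩ := hE.exists_apply_eq_one hij
  exact ⟨e, hH (Subgroup.mem_sup_left ⟨e, he, rfl⟩), h⟩

theorem IsAdmissible.eq_one_of_mem_groupH [Finite X] (hE : IsAdmissible p f n F b c E)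
    (hX : IsAlmostSimple X) (hF : ∀ x ∈ F, ∀ y ∈ F, Commute x y) {L : Subgroup (Wreath X n)}
    (hL : ∀ j x, ∃ m ∈ L.comap (base X n), m j = x) {N : Subgroup (Wreath X n)}
    (hNH : N ≤ groupH n E b c) (hN : ∀ l ∈ L, ∀ k ∈ N, l * k * l⁻¹ ∈ N) {x : Fin n → X}
    (hx : base X n x ∈ N) : x = 1 := by
  refine hX.eq_one_of_commutators_mem (N := N.comap (base X n)) hL (fun m hm k hk => ?_) hF
    (fun y hy z hz i => hE.apply_mem ?_ i) hx
  · simpa using hN _ hm _ hk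
  · have := commutator_mem_of_mem_sup hE.conj_mem
      (fun k hk l hl => commute_of_mem_zpowers hk hl) (hNH hy) (hNH hz)
    rwa [← map_inv, ← map_inv, ← map_mul, ← map_mul, ← map_mul, base_mem_map] at this

/-- As `o` centralizes `c`, it changes every entry of `d₀` by the same factor `a ^ z`, that is, by
`(θⁿ) ^ z`; and the diagonal commutes with `τ`. -/
theorem diag_conj_mem_zpowers (ha : theta n b c ^ n = base X n fun _ => a)
    (hob : b⁻¹ * (o * b * o⁻¹) ∈ Subgroup.zpowers a) (hoc : o * c * o⁻¹ = c)
    (hba : b ∈ Subgroup.zpowers a) :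
    ∀ k ∈ Subgroup.zpowers (theta n b c),
      diag n o * k * (diag n o)⁻¹ ∈ Subgroup.zpowers (theta n b c) := by
  obtain ⟨z, hz⟩ := hob
  simp only at hz
  have hob' : o * b * o⁻¹ = a ^ z * b := by
    have : Commute (a ^ z) b := commute_of_mem_zpowers ⟨z, rfl⟩ hba
    rw [this.eq, hz, mul_inv_cancel_left]
  have htau : diag n o * tau X n = tau X n * diag n o := by
    have := base_conj (tau X n) (fun _ => o)
    rw [mul_inv_eq_iff_eq_mul] at this
    rw [diag, this]
    congr 1
    refine congrArg _ (funext fun i => ?_)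
    simp [tau]
  have hd : diag n o * base X n (dZero n b c) * (diag n o)⁻¹ =
      (theta n b c ^ n) ^ z * base X n (dZero n b c) := by
    rw [ha, diag, ← map_inv, ← map_mul, ← map_mul, ← map_zpow, ← map_mul]
    congr 1
    funext i
    simp only [Pi.mul_apply, Pi.inv_apply, Pi.pow_apply, dZero]
    split_ifs
    · exact hob'
    · rw [show o * (b * c) * o⁻¹ = (o * b * o⁻¹) * (o * c * o⁻¹) by group, hob', hoc, mul_assoc]
  have hθ : diag n o * theta n b c * (diag n o)⁻¹ = (theta n b c ^ n) ^ z * theta n b c := by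
    calc _ = diag n o * base X n (dZero n b c) * (diag n o)⁻¹ *
          (diag n o * tau X n) * (diag n o)⁻¹ := by rw [theta]; group
      _ = _ := by rw [hd, htau, theta]; group
  rintro _ ⟨k, rfl⟩
  simp only
  rw [← conj_zpow, hθ]
  exact zpow_mem (mul_mem (zpow_mem (pow_mem (Subgroup.mem_zpowers _) n) z)
    (Subgroup.mem_zpowers _)) k

end Admissible


/-! ### Generation of `G`, trivial core, and the affine amalgam in `G` -/

section Amalgam

variable {X : Type*} [Group X] [Finite X] {p f n : ℕ} {F : Subgroup X} {b c o a : X}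
  {E : Subgroup (Fin n → X)}

theorem IsAdmissible.closure_eq_top (hE : IsAdmissible p f n F b c E) (hX : IsAlmostSimple X)
    (ha : theta n b c ^ n = base X n fun _ => a)
    (hba : b ∈ Subgroup.zpowers a) (hca : c ∈ Subgroup.zpowers a)
    (hgen : Subgroup.closure ((F : Set X) ∪ {b, c, o}) = ⊤)
    (hHG : groupH n E b c ≤ groupG n (socle X) b c) (hoG : diag n o ∈ groupG n (socle X) b c) :
    Subgroup.closure
      (((groupH n E b c).subgroupOf (groupG n (socle X) b c) : Set (groupG n (socle X) b c)) ∪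
        {⟨diag n o, hoG⟩}) = ⊤ := by
  rw [eq_top_iff]
  rintro g -
  set S := Subgroup.closure
      (((groupH n E b c).subgroupOf (groupG n (socle X) b c) : Set (groupG n (socle X) b c)) ∪
        {⟨diag n o, hoG⟩}) with hS
  have hHL : groupH n E b c ≤ S.map (groupG n (socle X) b c).subtype := fun h hh =>
    ⟨⟨h, hHG hh⟩, Subgroup.subset_closure (Or.inl hh), rfl⟩
  have hoL : diag n o ∈ S.map (groupG n (socle X) b c).subtype :=
    ⟨⟨diag n o, hoG⟩, Subgroup.subset_closure (Or.inr rfl), rfl⟩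
  obtain ⟨g', hg', h⟩ := hE.groupG_le hX hHL (hE.exists_apply_eq ha hba hca hgen hHL hoL) g.2
  rwa [← Subtype.ext h]

theorem IsAdmissible.normalCore_eq_bot (hE : IsAdmissible p f n F b c E) (hX : IsAlmostSimple X)
    (hF : ∀ x ∈ F, ∀ y ∈ F, Commute x y)
    (hL : ∀ j x, ∃ m ∈ (groupG n (socle X) b c).comap (base X n), m j = x) :
    ((groupH n E b c).subgroupOf (groupG n (socle X) b c)).normalCore = ⊥ := by
  set C := ((groupH n E b c).subgroupOf (groupG n (socle X) b c)).normalCore with hC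
  have hCn : C.Normal := Subgroup.normalCore_normal _
  have hCH : C.map (groupG n (socle X) b c).subtype ≤ groupH n E b c :=
    Subgroup.map_le_iff_le_comap.2 (Subgroup.normalCore_le _)
  have hnorm : ∀ l ∈ groupG n (socle X) b c, ∀ k ∈ C.map (groupG n (socle X) b c).subtype,
      l * k * l⁻¹ ∈ C.map (groupG n (socle X) b c).subtype := by
    rintro l hl _ ⟨k, hk, rfl⟩
    exact ⟨_, hCn.conj_mem k hk ⟨l, hl⟩, rfl⟩
  have hone : ∀ x, base X n x ∈ C.map (groupG n (socle X) b c).subtype → x = 1 :=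
    fun x hx => hE.eq_one_of_mem_groupH hX hF hL hCH hnorm hx
  obtain ⟨-, t, ht, u, -, htu⟩ := id hX
  have ht1 : t ≠ 1 := by rintro rfl; exact htu (Commute.one_left u)
  rw [Subgroup.eq_bot_iff_forall]
  intro g hg
  refine Subtype.ext (eq_one_of_disjoint_base ht ht1 (fun l hl k hk => ?_) hone ⟨g, hg, rfl⟩)
  exact hnorm l (Subgroup.mem_sup_left hl) k hk

theorem IsAdmissible.isAffineAmalgam (hE : IsAdmissible p f n F b c E) (hX : IsAlmostSimple X)
    (hF : ∀ x ∈ F, ∀ y ∈ F, Commute x y) (hE1 : E ≠ ⊥)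
    (ha : theta n b c ^ n = base X n fun _ => a)
    (hba : b ∈ Subgroup.zpowers a) (hca : c ∈ Subgroup.zpowers a)
    (hgen : Subgroup.closure ((F : Set X) ∪ {b, c, o}) = ⊤)
    (hHG : groupH n E b c ≤ groupG n (socle X) b c) (hoG : diag n o ∈ groupG n (socle X) b c)
    (hoo : o * o = 1) (hok : ∀ k ∈ Subgroup.zpowers (theta n b c),
      diag n o * k * (diag n o)⁻¹ ∈ Subgroup.zpowers (theta n b c)) :
    IsAffineAmalgam ((groupH n E b c).subgroupOf (groupG n (socle X) b c))
      ((E.map (base X n)).subgroupOf (groupG n (socle X) b c))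
      ((Subgroup.zpowers (theta n b c)).subgroupOf (groupG n (socle X) b c))
      ⟨diag n o, hoG⟩ :=
  have hoo' : (⟨diag n o, hoG⟩ : groupG n (socle X) b c) * ⟨diag n o, hoG⟩ = 1 := Subtype.ext (by
    change diag n o * diag n o = 1
    rw [diag, ← map_mul, ← map_one (base X n)]
    exact congrArg _ (funext fun _ => hoo))
  { left_le := fun _ hx => Subgroup.mem_sup_left (T := Subgroup.zpowers (theta n b c)) hx
    right_le := fun _ hx => Subgroup.mem_sup_right (S := E.map (base X n)) hx
    exists_mul := fun h hh => by
      obtain ⟨k, hk, e, he, heq⟩ := exists_mul_of_mem_sup hE.conj_mem hh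
      exact ⟨⟨k, hHG (Subgroup.mem_sup_right hk)⟩, hk, ⟨e, hHG (Subgroup.mem_sup_left he)⟩, he,
        Subtype.ext heq⟩
    transitive := fun x hx y hy hx1 hy1 => by
      obtain ⟨k, hk, h⟩ := hE.transitive_map x hx y hy (fun h => hx1 (Subtype.ext h))
        (fun h => hy1 (Subtype.ext h))
      exact ⟨⟨k, hHG (Subgroup.mem_sup_right hk)⟩, hk, Subtype.ext h⟩
    conj_mem := fun k hk => hok k hk
    mul_self := hoo'
    not_normalizes := fun h => by
      set H := (groupH n E b c).subgroupOf (groupG n (socle X) b c)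
      -- If `𝐨` normalized `H`, then `H` would be normal in `G = ⟨H, 𝐨⟩`, and the argument for the
      -- core with `N = H` would give `E = 1`.
      have hnormal : H.Normal := normal_of_closure_eq_top hoo' h
        (hE.closure_eq_top hX ha hba hca hgen hHG hoG)
      obtain ⟨e, he, he1⟩ := E.bot_or_exists_ne_one.resolve_left hE1
      refine he1 (hE.eq_one_of_mem_groupH hX hF (hE.exists_apply_eq ha hba hca hgen hHG hoG) le_rfl
        (fun l hl k hk => ?_) (Subgroup.mem_sup_left ⟨e, he, rfl⟩))
      exact hnormal.conj_mem ⟨k, hHG hk⟩ hk ⟨l, hl⟩ }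

end Amalgam

end CosetGraphPA

/-! ### The main theorem -/

theorem mainTheorem6 {X : Type*} [Group X] [Finite X]
    -- the arithmetic conditions
    (p f q n s r t : ℕ) [Fact p.Prime] (hf : 1 ≤ f) (hq : q = p ^ f) (hn : n = q + 1)
    (hnrs : n = 2 ^ s * r ^ t) (hn3 : 3 < n) (hr : r.Prime) (hr2 : Odd r)
    (hs : 2 ≤ s ∨ Even q)
    -- the almost simple group `X` with socle `T`, and `AGL₁(q) ≅ R = F : (⟨b⟩ × ⟨c⟩) ≤ X`
    (hX : IsAlmostSimple X) (T : Subgroup X) (hT : T = socle X) (hXT : T.index ≤ 2)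
    (R F : Subgroup X) (b c : X) (hR : Nonempty (R ≃* AGL1 p f))
    (hRF : IsInternalSemidirect R F (Subgroup.zpowers b ⊔ Subgroup.zpowers c))
    (hbc : IsInternalDirect (Subgroup.zpowers b ⊔ Subgroup.zpowers c)
      (Subgroup.zpowers b) (Subgroup.zpowers c))
    (hF : Nonempty (F ≃* ElemAb p f))
    (hb : orderOf b = (q - 1) / Nat.gcd 2 (q - 1)) (hc : orderOf c = Nat.gcd 2 (q - 1))
    -- the minimal normal subgroup `E` of `F ^ n : ⟨θ⟩`
    (E : Subgroup (Fin n → X)) (hE : IsAdmissible p f n F b c E)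
    -- the involution `o`
    (o : X) (ho : orderOf o = 2) (hoT : o ∈ T)
    (hoN : o ∈ Subgroup.normalizer (Subgroup.closure {b, c} : Set X))
    (hgen : Subgroup.closure ((F : Set X) ∪ {b, c, o}) = ⊤) :
    groupH n E b c ≤ groupG n T b c ∧
    ∃ (hoG : diag n o ∈ groupG n T b c)
      (hcos : IsCosetGraphElement ((groupH n E b c).subgroupOf (groupG n T b c))
        (⟨diag n o, hoG⟩ : groupG n T b c)),
      (cosetGraph _ _ hcos).Connected ∧
      IsTwoArcTransitive (groupG n T b c)ᵐᵒᵖ (cosetGraph _ _ hcos) ∧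
      ∀ v, ((cosetGraph _ _ hcos).neighborSet v).ncard = q ^ 2 := by
  subst hT
  have hq3 : 3 ≤ q := by omega
  have hm : Odd ((q - 1) / Nat.gcd 2 (q - 1)) := by
    refine odd_div_gcd (by omega) (hs.symm.imp_right fun hs => ?_)
    rw [← hn, hnrs]
    exact Dvd.dvd.mul_right (pow_dvd_pow 2 hs) _
  have hcomm : Commute b c :=
    hbc.commute b (Subgroup.mem_zpowers b) c (Subgroup.mem_zpowers c)
  have hbm : b ^ ((q - 1) / Nat.gcd 2 (q - 1)) = 1 := hb ▸ pow_orderOf_eq_one b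
  have hc2 : c ^ 2 = 1 := orderOf_dvd_iff_pow_eq_one.1 (hc ▸ Nat.gcd_dvd_left _ _)
  obtain ⟨hba, hca⟩ := mem_zpowers_sq_mul hcomm hm hbm hc2
  subst hn
  have ha : theta (q + 1) b c ^ (q + 1) = base X (q + 1) fun _ => b ^ 2 * c := by
    rw [theta_pow_card hcomm (by omega), pow_mul_pow_eq_sq_mul (by omega) hb hc]
  have hKa : Subgroup.closure {b, c} ≤ Subgroup.zpowers (b ^ 2 * c) := by
    rw [Subgroup.closure_le]
    rintro x (rfl | rfl)
    exacts [hba, hca]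
  have hoK : ∀ x ∈ ({b, c} : Set X), o * x * o⁻¹ ∈ Subgroup.zpowers (b ^ 2 * c) := fun x hx =>
    hKa ((Subgroup.mem_normalizer_iff.1 hoN x).1 (Subgroup.subset_closure hx))
  have hoc := conj_eq_of_mem_normalizer hcomm hm hbm hc2 (hoK c (by simp))
  have hok := diag_conj_mem_zpowers ha (mul_mem (inv_mem hba) (hoK b (by simp))) hoc hba
  have hoo : o * o = 1 := by rw [← sq, ← ho, pow_orderOf_eq_one]
  have hFc : ∀ x ∈ F, ∀ y ∈ F, Commute x y := by
    obtain ⟨φ⟩ := hF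
    intro x hx y hy
    have : (⟨x, hx⟩ : F) * ⟨y, hy⟩ = ⟨y, hy⟩ * ⟨x, hx⟩ :=
      φ.injective (by rw [map_mul, map_mul, mul_comm])
    exact congrArg Subtype.val this
  have hcard : Nat.card E = q ^ 2 := by rw [hE.card_eq, hq]
  have hE1 : E ≠ ⊥ := by
    rintro rfl
    rw [Subgroup.card_bot] at hcard
    nlinarith
  have hHG : groupH (q + 1) E b c ≤ groupG (q + 1) (socle X) b c :=
    -- The size condition is `q + 2 < q²`, which holds because `q ≥ 3`.
    groupH_le_groupG fun e he i => hE.le_pi hXT (by omega) (by rw [hcard]; nlinarith) ha he i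
  have hoG : diag (q + 1) o ∈ groupG (q + 1) (socle X) b c :=
    Subgroup.mem_sup_left (base_mem_power.2 fun _ => hoT)
  have hA := hE.isAffineAmalgam hX hFc hE1 ha hba hca hgen hHG hoG hoo hok
  have hEG : E.map (base X (q + 1)) ≤ groupG (q + 1) (socle X) b c := le_sup_left.trans hHG
  have hcardG : Nat.card ((E.map (base X (q + 1))).subgroupOf (groupG (q + 1) (socle X) b c)) =
      q ^ 2 := by
    rw [Nat.card_congr (Subgroup.subgroupOfEquivOfLe hEG).toEquiv, card_map_base, hcard]
  refine ⟨hHG, hoG, hA.isCosetGraphElement, ?_, ?_, fun v => ?_⟩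
  · exact cosetGraph_connected _ _ _ (hE.closure_eq_top hX ha hba hca hgen hHG hoG)
  · refine hA.isTwoArcTransitive _ (hE.normalCore_eq_bot hX hFc
      (hE.exists_apply_eq ha hba hca hgen hHG hoG)) fun h => ?_
    rw [h, Subgroup.card_bot] at hcardG
    nlinarith
  · rw [hA.ncard_neighborSet, hcardG]
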